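/- Lemma 2. Consider a two-tier network in the plane $\mathbb{R}^2$ whose macro base stations (tier $M$) and small-cell base stations (tier $S$) form independent homogeneous Poisson point processes $\Phi_M,\Phi_S$ with densities $\lambda_M,\lambda_S>0$. Tier $k\in\{M,S\}$ has downlink transmit power $P_k>0$, uplink transmit power $Q_k>0$, antenna gain $G_k>0$ and path loss exponent $\alpha_k>0$; put $\bar P_k=P_kG_k$, $\bar Q_k=Q_kG_k$ and assume $\bar Q_S/\bar Q_M>\bar P_S/\bar P_M$. The typical user is at the origin. In uplink it associates with a base station $x^*\in\Phi_l$ if and only if $\bar Q_l\|x^*\|^{-\alpha_l}\ge \bar Q_k\|x\|^{-\alpha_k}$ for all $k\in\{M,S\}$ and $x\in\Phi_k$, and in downlink likewise with $\bar P$ in place of $\bar Q$. Let $X_k$ be the distance from the origin to the nearest point of $\Phi_k$. Let Case 2 (the decoupled case) be the event that the user associates with a small-cell base station in uplink and with a macro base station in downlink; equivalently, up to an event of probability zero, that $$X_M^{-\alpha_M}>\frac{\bar P_S}{\bar P_M}X_S^{-\alpha_S}\quad\text{and}\quad X_M^{-\alpha_M}\le\frac{\bar Q_S}{\bar Q_M}X_S^{-\alpha_S}.$$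 Then $$\Pr(\mathrm{Case\ 2})=\frac12\,\frac{\alpha_M}{\alpha_S}\left(H^{1,1}_{1,1}\!\left[z_1\,\middle|\,\begin{matrix}(0,\frac12)\\(0,\frac12\frac{\alpha_M}{\alpha_S})\end{matrix}\right]-H^{1,1}_{1,1}\!\left[z_2\,\middle|\,\begin{matrix}(0,\frac12)\\(0,\frac12\frac{\alpha_M}{\alpha_S})\end{matrix}\right]\right),$$ where $$z_1=\frac{(\sqrt{\pi\lambda_M})^{\alpha_M/\alpha_S}}{\sqrt{\pi\lambda_S}}\left(\frac{\bar Q_M}{\bar Q_S}\right)^{1/\alpha_S},\qquad z_2=\frac{(\sqrt{\pi\lambda_M})^{\alpha_M/\alpha_S}}{\sqrt{\pi\lambda_S}}\left(\frac{\bar P_M}{\bar P_S}\right)^{1/\alpha_S}.$$ Here $H^{1,1}_{1,1}$ is Fox's H-function, $H^{1,1}_{1,1}\!\left[z\,\middle|\,\begin{matrix}(a,A)\\(b,B)\end{matrix}\right]=\frac1{2\pi i}\int_L\Gamma(b+Bs)\,\Gamma(1-a-As)\,z^{-s}\,ds$, where $L$ is an upward vertical line that has the poles of $\Gamma(b+Bs)$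 on its left and the poles of $\Gamma(1-a-As)$ on its right; at $z_1$ and $z_2$, for the parameters above, such lines exist, the integral converges absolutely along each of them, and its value does not depend on the choice of $L$. -/

import Mathlib

open MeasureTheory ProbabilityTheory

/-! ### Fox's H-function

A parameter row is a family of pairs `(aᵢ, Aᵢ)` with `aᵢ` complex and `Aᵢ` a positive real. -/

/-- The Mellin-Barnes kernel of `H^{m,n}_{p,q}`,
`∏_{j ≤ m} Γ(b_j + B_j s) ∏_{i ≤ n} Γ(1 - a_i - A_i s) /
  (∏_{i > n} Γ(a_i + A_i s) ∏_{j > m} Γ(1 - b_j - B_j s))`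
(the indices are counted from `0` here). -/
noncomputable def foxKernel (m n p q : ℕ) (a : Fin p → ℂ × ℝ) (b : Fin q → ℂ × ℝ) (s : ℂ) : ℂ :=
  (∏ j : Fin q, if (j : ℕ) < m then Complex.Gamma ((b j).1 + (b j).2 * s)
      else (Complex.Gamma (1 - (b j).1 - (b j).2 * s))⁻¹) *
  (∏ i : Fin p, if (i : ℕ) < n then Complex.Gamma (1 - (a i).1 - (a i).2 * s)
      else (Complex.Gamma ((a i).1 + (a i).2 * s))⁻¹)

/-- The vertical line `Re s = γ` is an admissible contour: all poles `-(b_j + k) / B_j` of the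
`Γ(b_j + B_j s)`, `j ≤ m`, lie on its left, and all poles `(1 - a_i + k) / A_i` of the
`Γ(1 - a_i - A_i s)`, `i ≤ n`, lie on its right. -/
def FoxSeparates (m n p q : ℕ) (a : Fin p → ℂ × ℝ) (b : Fin q → ℂ × ℝ) (γ : ℝ) : Prop :=
  (∀ j : Fin q, (j : ℕ) < m → ∀ k : ℕ, (-((b j).1 + k) / ((b j).2 : ℂ)).re < γ) ∧
  (∀ i : Fin p, (i : ℕ) < n → ∀ k : ℕ, γ < ((1 - (a i).1 + k) / ((a i).2 : ℂ)).re)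

/-- The integrand of the Mellin-Barnes integral at the point `s = γ + i t`. -/
noncomputable def foxIntegrand (m n p q : ℕ) (a : Fin p → ℂ × ℝ) (b : Fin q → ℂ × ℝ)
    (z : ℂ) (γ t : ℝ) : ℂ :=
  foxKernel m n p q a b (γ + t * Complex.I) * z ^ (-(γ + t * Complex.I : ℂ))

/-- The integral `(2πi)⁻¹ ∫ foxKernel(s) z^{-s} ds` along the line `Re s = γ`, directed upwards,
parametrized by `s = γ + i t`, `ds = i dt`. -/
noncomputable def foxLineIntegral (m n p q : ℕ) (a : Fin p → ℂ × ℝ) (b : Fin q → ℂ × ℝ)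
    (z : ℂ) (γ : ℝ) : ℂ :=
  (2 * Real.pi * Complex.I)⁻¹ * ∫ t : ℝ, foxIntegrand m n p q a b z γ t * Complex.I

open Classical in
/-- Fox's H-function `H^{m,n}_{p,q}[z | (a_i, A_i); (b_j, B_j)]`: the Mellin-Barnes integral along
a vertical line that separates the two families of poles (`0` if there is no such line). -/
noncomputable def foxH (m n p q : ℕ) (a : Fin p → ℂ × ℝ) (b : Fin q → ℂ × ℝ) (z : ℂ) : ℂ :=
  if h : ∃ γ : ℝ, FoxSeparates m n p q a b γ then foxLineIntegral m n p q a b z h.choose else 0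

/-- The H-function is well defined at `z`: a separating vertical line exists, and the integral
along each such line converges absolutely and has the same value, `foxH`. -/
def FoxHWellDefined (m n p q : ℕ) (a : Fin p → ℂ × ℝ) (b : Fin q → ℂ × ℝ) (z : ℂ) : Prop :=
  (∃ γ : ℝ, FoxSeparates m n p q a b γ) ∧
  ∀ γ : ℝ, FoxSeparates m n p q a b γ →
    Integrable (foxIntegrand m n p q a b z γ) ∧
    foxLineIntegral m n p q a b z γ = foxH m n p q a b z

/-! ### Poisson point processes in the plane -/

/-- The Euclidean plane. -/
abbrev Plane : Type := EuclideanSpace ℝ (Fin 2)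

/-- The number of points of the random set `Φ` in `B`. -/
noncomputable def pointCount {Ω : Type*} (Φ : Ω → Set Plane) (B : Set Plane) (ω : Ω) : ℕ∞ :=
  (Φ ω ∩ B).encard

/-- `Φ` is a homogeneous Poisson point process in the plane with density `lam`. -/
structure IsHomogeneousPPP {Ω : Type*} [MeasurableSpace Ω] (P : Measure Ω)
    (Φ : Ω → Set Plane) (lam : ℝ) : Prop where
  measurable_count : ∀ B : Set Plane, MeasurableSet B → Measurable (pointCount Φ B)
  locallyFinite : ∀ᵐ ω ∂P, ∀ K : Set Plane, Bornology.IsBounded K → (Φ ω ∩ K).Finite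
  poisson : ∀ B : Set Plane, MeasurableSet B → volume B ≠ ⊤ → ∀ n : ℕ,
    P {ω | pointCount Φ B ω = n} =
      ENNReal.ofReal (Real.exp (-(lam * volume.real B)) * (lam * volume.real B) ^ n / n.factorial)
  indep : ∀ (n : ℕ) (B : Fin n → Set Plane), (∀ i, MeasurableSet (B i)) →
    Pairwise (fun i j => Disjoint (B i) (B j)) → iIndepFun (fun i => pointCount Φ (B i)) P

/-- The σ-algebra generated by a point process, that is, by its counts in Borel sets. -/
@[reducible]
noncomputable def pointProcessSigma {Ω : Type*} (Φ : Ω → Set Plane) : MeasurableSpace Ω :=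
  ⨆ (B : Set Plane) (_ : MeasurableSet B), MeasurableSpace.comap (pointCount Φ B) inferInstance

/-! ### The two-tier network and cell association -/

/-- The two tiers: macro cells and small cells. -/
inductive Tier : Type
  | Mcell
  | Scell

/-- `x` is a base station of tier `l` with which the user at the origin associates, when
`W k = (transmit power) * (antenna gain)` for tier `k`, `α k` is its path loss exponent and `φ k`
is its set of base stations: no base station of either tier has a larger received power. -/
def IsServing (W α : Tier → ℝ) (φ : Tier → Set Plane) (l : Tier) (x : Plane) : Prop :=
  x ∈ φ l ∧ ∀ k : Tier, ∀ y ∈ φ k, W k * ‖y‖ ^ (-α k) ≤ W l * ‖x‖ ^ (-α l)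

/-- The decoupled case: the user at the origin associates in uplink (powers `Q`) with a small cell
base station and in downlink (powers `Pt`) with a macro cell base station. -/
def decoupledCase {Ω : Type*} (Φ : Tier → Ω → Set Plane) (Pt Q G α : Tier → ℝ) : Set Ω :=
  {ω | (∃ x, IsServing (fun k => Q k * G k) α (fun k => Φ k ω) Tier.Scell x) ∧
    (∃ x, IsServing (fun k => Pt k * G k) α (fun k => Φ k ω) Tier.Mcell x)}

/-- The distance from the origin to the nearest point of the process. -/
noncomputable def nearestDist {Ω : Type*} (Φ : Ω → Set Plane) (ω : Ω) : ℝ :=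
  Metric.infDist 0 (Φ ω)

/-- The decoupled case in terms of the distances `X_k` to the nearest base stations:
`X_M^{-α_M} > (P_S G_S)/(P_M G_M) X_S^{-α_S}` and `X_M^{-α_M} ≤ (Q_S G_S)/(Q_M G_M) X_S^{-α_S}`. -/
def decoupledCaseDist {Ω : Type*} (Φ : Tier → Ω → Set Plane) (Pt Q G α : Tier → ℝ) : Set Ω :=
  {ω | nearestDist (Φ Tier.Mcell) ω ^ (-α Tier.Mcell) >
        (Pt Tier.Scell * G Tier.Scell) / (Pt Tier.Mcell * G Tier.Mcell) *
          nearestDist (Φ Tier.Scell) ω ^ (-α Tier.Scell) ∧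
      nearestDist (Φ Tier.Mcell) ω ^ (-α Tier.Mcell) ≤
        (Q Tier.Scell * G Tier.Scell) / (Q Tier.Mcell * G Tier.Mcell) *
          nearestDist (Φ Tier.Scell) ω ^ (-α Tier.Scell)}

/-- The argument
`(√(π lam_M))^{α_M/α_S} ((W_M G_M)/(W_S G_S))^{1/α_S} (√(π lam_S))⁻¹` of the H-functions. -/
noncomputable def foxArg (lam W G α : Tier → ℝ) : ℝ :=
  √(Real.pi * lam Tier.Mcell) ^ (α Tier.Mcell / α Tier.Scell) *
    ((W Tier.Mcell * G Tier.Mcell) / (W Tier.Scell * G Tier.Scell)) ^ (1 / α Tier.Scell) *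
    (√(Real.pi * lam Tier.Scell))⁻¹

/-- `H^{1,1}_{1,1}[z | (0, 1/2); (0, (1/2) (α_M/α_S))]`. -/
noncomputable def assocH (α : Tier → ℝ) (z : ℝ) : ℂ :=
  foxH 1 1 1 1 ![(0, 1 / 2)] ![(0, 1 / 2 * (α Tier.Mcell / α Tier.Scell))] z

/-!
With `U_k = π lam_k X_k²`, where `X_k` is the distance from the origin to the nearest point of the
tier `k`, the void probabilities of a Poisson process say that `U_k` is exponential of rate one
(`IsHomogeneousPPP.map_nearestDist`), and independence of the tiers makes `U_M` and `U_S`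
independent (`map_nearestDist_prod`). For powers `W` the nearest small-cell base station is received
at least as strongly as the nearest macro base station when `(z √U_S)^{2 α_S / α_M} ≤ U_M`, with
`z = foxArg lam W G α` (`rpow_neg_le_iff_foxArg`). Conditioning on `U_S`, this has probability
`∫₀^∞ e^{-v} exp (-(z √v)^{2 α_S / α_M}) dv`, and ties are null (`measureReal_macro_le_small`). A
user who prefers the small cell in downlink also does so in uplink, because of the order of the power
ratios, so the probability of the decoupled case is the difference of two such integrals.

It remains to recognize the integral as an H-function (`integral_foxIntegrand`). Put
`B = α_M / (2 α_S)`. In the Mellin-Barnes integral of `Γ(B s) Γ(1 - s/2) z^{-s}` the second factor is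
written as `∫₀^∞ e^{-v} v^{-s/2} dv`. The double integral converges absolutely since `Γ` decays at
least quadratically on vertical lines (`Complex.norm_Gamma_vertical_le`), and for fixed `v` the
integral over the line is the Mellin inversion of `x ↦ B⁻¹ exp (-x^{1/B})` at `x = z √v`. The result
does not mention the line, which also gives independence of the contour.

The description of association by serving base stations agrees with the one by nearest distances
outside a null set: almost surely both tiers are nonempty and locally finite, no point is at the
origin, and there is no tie (`exists_isServing_iff`).
-/

/-! ### Integrability of the Gamma function on vertical lines -/

theorem Complex.norm_Gamma_le_Gamma_re {s : ℂ} (hs : 0 < s.re) :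
    ‖Complex.Gamma s‖ ≤ Real.Gamma s.re := by
  rw [Complex.Gamma_eq_integral hs, Complex.GammaIntegral, Real.Gamma_eq_integral hs]
  refine (norm_integral_le_integral_norm _).trans_eq ?_
  refine setIntegral_congr_fun measurableSet_Ioi fun x (hx : 0 < x) ↦ ?_
  simp [Complex.norm_cpow_eq_rpow_re_of_pos hx, Complex.norm_exp]

/-- Two steps of the functional equation turn the trivial bound `‖Γ s‖ ≤ Γ (re s)` into quadratic
decay along a vertical line. -/
theorem Complex.norm_Gamma_vertical_le {x : ℝ} (hx : 0 < x) (y : ℝ) :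
    ‖Complex.Gamma (x + y * Complex.I)‖ ≤
      Real.Gamma (x + 2) * (min 1 x)⁻¹ * (1 + y ^ 2)⁻¹ := by
  set s : ℂ := x + y * Complex.I with hs
  have hre : s.re = x := by simp [hs]
  have him : s.im = y := by simp [hs]
  have h0 : s ≠ 0 := fun h ↦ by simp [h] at hre; linarith
  have h1 : s + 1 ≠ 0 := fun h ↦ by
    have := congrArg Complex.re h
    simp [hre] at this; linarith
  have hG : Complex.Gamma (s + 1 + 1) = (s + 1) * (s * Complex.Gamma s) := by
    rw [Complex.Gamma_add_one _ h1, Complex.Gamma_add_one _ h0]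
  have hm : 0 < min 1 x := lt_min one_pos hx
  have hm1 : min 1 x ≤ 1 := min_le_left _ _
  have hmx : min 1 x ≤ x := min_le_right _ _
  have hb : ‖Complex.Gamma (s + 1 + 1)‖ ≤ Real.Gamma (x + 2) := by
    have := Complex.norm_Gamma_le_Gamma_re (s := s + 1 + 1) (by simp [hre]; linarith)
    convert this using 2
    simp [hre]; ring
  have hns : min 1 x * √(1 + y ^ 2) ≤ ‖s‖ := by
    rw [Complex.norm_eq_sqrt_sq_add_sq, hre, him, ← Real.sqrt_sq hm.le,
      ← Real.sqrt_mul (sq_nonneg _)]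
    apply Real.sqrt_le_sqrt
    nlinarith [sq_nonneg y, mul_le_mul hmx hmx hm.le hx.le, mul_le_mul hm1 hm1 hm.le one_pos.le]
  have hns1 : √(1 + y ^ 2) ≤ ‖s + 1‖ := by
    rw [Complex.norm_eq_sqrt_sq_add_sq]
    apply Real.sqrt_le_sqrt
    simp only [Complex.add_re, hre, Complex.one_re, Complex.add_im, him, Complex.one_im, add_zero]
    nlinarith
  have hprod : min 1 x * (1 + y ^ 2) ≤ ‖s + 1‖ * ‖s‖ := by
    have h := mul_le_mul hns1 hns (by positivity) (norm_nonneg _)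
    have h2 := Real.mul_self_sqrt (show 0 ≤ 1 + y ^ 2 by positivity)
    nlinarith
  rw [hG, norm_mul, norm_mul, ← mul_assoc] at hb
  have hpos : 0 < min 1 x * (1 + y ^ 2) := by positivity
  rw [mul_assoc, ← mul_inv, ← div_eq_mul_inv, le_div_iff₀ hpos, mul_comm]
  exact (mul_le_mul_of_nonneg_right hprod (norm_nonneg _)).trans hb

theorem Complex.continuous_Gamma_vertical {x : ℝ} (hx : 0 < x) :
    Continuous fun y : ℝ ↦ Complex.Gamma (x + y * Complex.I) := by
  refine continuous_iff_continuousAt.2 fun y ↦ ContinuousAt.comp (g := Complex.Gamma)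
    (Complex.differentiableAt_Gamma _ fun m h ↦ ?_).continuousAt (by fun_prop)
  have := congrArg Complex.re h
  simp at this
  have hm : (0 : ℝ) ≤ m := m.cast_nonneg
  linarith

theorem Complex.verticalIntegrable_Gamma {x : ℝ} (hx : 0 < x) :
    Complex.VerticalIntegrable Complex.Gamma x := by
  refine Integrable.mono'
    (g := fun y ↦ Real.Gamma (x + 2) * (min 1 x)⁻¹ * (1 + y ^ 2)⁻¹)
    (integrable_inv_one_add_sq.const_mul _)
    (Complex.continuous_Gamma_vertical hx).aestronglyMeasurable ?_
  exact Filter.Eventually.of_forall (Complex.norm_Gamma_vertical_le hx)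

theorem integrable_Gamma_mul_vertical {B γ : ℝ} (hB : 0 < B) (hγ : 0 < γ) :
    Integrable fun t : ℝ ↦ Complex.Gamma (B * (γ + t * Complex.I)) := by
  have h := (Complex.verticalIntegrable_Gamma (mul_pos hB hγ)).comp_mul_left' hB.ne'
  convert h using 2 with t
  push_cast
  ring_nf

/-! ### Mellin inversion of the stretched exponential -/

theorem mellin_exp_neg_rpow {B : ℝ} (hB : 0 < B) {s : ℂ} (hs : 0 < s.re) :
    mellin (fun x : ℝ ↦ (Real.exp (-x ^ (1 / B)) : ℂ)) s = B * Complex.Gamma (B * s) := by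
  rw [mellin_comp_rpow (fun x : ℝ ↦ (Real.exp (-x) : ℂ)) s (1 / B),
    ← Complex.GammaIntegral_eq_mellin, ← Complex.Gamma_eq_integral]
  · rw [abs_of_pos (by positivity), Complex.real_smul]
    push_cast
    congr 2
    · simp
    · field_simp
  · have : s / ((1 / B : ℝ) : ℂ) = (B : ℂ) * s := by push_cast; field_simp
    rw [this, Complex.re_ofReal_mul]
    positivity

theorem mellinConvergent_exp_neg_rpow {B : ℝ} (hB : 0 < B) {s : ℂ} (hs : 0 < s.re) :
    MellinConvergent (fun x : ℝ ↦ (Real.exp (-x ^ (1 / B)) : ℂ)) s := by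
  rw [MellinConvergent.comp_rpow (f := fun x : ℝ ↦ (Real.exp (-x) : ℂ))
    (a := 1 / B) (by positivity)]
  have hs' : 0 < (s / ((1 / B : ℝ) : ℂ)).re := by
    have : s / ((1 / B : ℝ) : ℂ) = (B : ℂ) * s := by push_cast; field_simp
    rw [this, Complex.re_ofReal_mul]
    positivity
  refine (Complex.GammaIntegral_convergent hs').congr_fun (fun x _ ↦ ?_) measurableSet_Ioi
  simp [mul_comm]

theorem integral_Gamma_mul_cpow {B γ x : ℝ} (hB : 0 < B) (hγ : 0 < γ) (hx : 0 < x) :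
    (2 * Real.pi : ℂ)⁻¹ * ∫ t : ℝ, (x : ℂ) ^ (-(γ + t * Complex.I : ℂ)) *
      Complex.Gamma (B * (γ + t * Complex.I)) = (B : ℂ)⁻¹ * Real.exp (-x ^ (1 / B)) := by
  have hmel : ∀ t : ℝ, mellin (fun x : ℝ ↦ (Real.exp (-x ^ (1 / B)) : ℂ)) (γ + t * Complex.I) =
      B * Complex.Gamma (B * (γ + t * Complex.I)) := fun t ↦
    mellin_exp_neg_rpow hB (by simpa using hγ)
  have h := mellinInv_mellin_eq γ (fun x : ℝ ↦ (Real.exp (-x ^ (1 / B)) : ℂ)) hx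
    (mellinConvergent_exp_neg_rpow hB (by simpa using hγ)) ?_ ?_
  · rw [mellinInv] at h
    simp_rw [hmel] at h
    rw [← h, Complex.real_smul, ← integral_const_mul, ← integral_const_mul, ← integral_const_mul]
    congr 1
    ext t
    have : (B : ℂ) ≠ 0 := by exact_mod_cast hB.ne'
    simp only [smul_eq_mul]
    push_cast
    field_simp
  · rw [Complex.VerticalIntegrable]
    simp_rw [hmel]
    exact (integrable_Gamma_mul_vertical hB hγ).const_mul _
  · have : ContinuousAt (fun x : ℝ ↦ x ^ (1 / B)) x :=
      Real.continuousAt_rpow_const _ _ (Or.inl hx.ne')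
    exact Complex.continuous_ofReal.continuousAt.comp
      (Real.continuous_exp.continuousAt.comp this.neg)

/-! ### The H-function `H^{1,1}_{1,1}[z | (0, A); (0, B)]` -/

theorem foxSeparates_one_one_iff {A B γ : ℝ} (hA : 0 < A) (hB : 0 < B) :
    FoxSeparates 1 1 1 1 ![(0, A)] ![(0, B)] γ ↔ 0 < γ ∧ γ < 1 / A := by
  have h1 : ∀ k : ℕ, (-((0 : ℂ) + k) / (B : ℂ)).re = -(k / B) := fun k ↦ by
    rw [Complex.div_ofReal_re]; simp [neg_div]
  have h2 : ∀ k : ℕ, ((1 - (0 : ℂ) + k) / (A : ℂ)).re = (1 + k) / A := fun k ↦ by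
    rw [Complex.div_ofReal_re]; simp
  simp only [FoxSeparates, Fin.forall_fin_one, Fin.val_zero, zero_lt_one, forall_const,
    Matrix.cons_val_fin_one, h1, h2]
  constructor
  · rintro ⟨h, h'⟩
    exact ⟨by simpa using h 0, by simpa using h' 0⟩
  · rintro ⟨h, h'⟩
    refine ⟨fun k ↦ lt_of_le_of_lt (neg_nonpos.2 (by positivity)) h, fun k ↦ h'.trans_le ?_⟩
    gcongr
    simp

theorem foxIntegrand_one_one (A B γ t : ℝ) (z : ℂ) :
    foxIntegrand 1 1 1 1 ![(0, A)] ![(0, B)] z γ t =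
      Complex.Gamma (B * (γ + t * Complex.I)) * Complex.Gamma (1 - A * (γ + t * Complex.I)) *
        z ^ (-(γ + t * Complex.I : ℂ)) := by
  simp [foxIntegrand, foxKernel]

/-- The absolutely convergent double integral behind the Mellin-Barnes integral: the inner integral
over `v` is `Γ(1 - A s)`, the inner integral over `t` is a Mellin inversion. -/
theorem integrable_foxIntegrand_prod {A B γ z : ℝ} (hB : 0 < B) (hγ : 0 < γ)
    (hγA : A * γ < 1) (hz : 0 < z) :
    Integrable (fun p : ℝ × ℝ ↦ Complex.Gamma (B * (γ + p.1 * Complex.I)) *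
      (z : ℂ) ^ (-(γ + p.1 * Complex.I : ℂ)) * ((Real.exp (-p.2) : ℂ) *
        (p.2 : ℂ) ^ (1 - A * (γ + p.1 * Complex.I) - 1 : ℂ)))
      (volume.prod (volume.restrict (Set.Ioi 0))) := by
  have hG := (integrable_Gamma_mul_vertical hB hγ).norm.mul_const (z ^ (-γ))
  have hE := Real.GammaIntegral_convergent (s := 1 - A * γ) (by linarith)
  have hmeas : Measurable fun t : ℝ ↦ Complex.Gamma (B * (γ + t * Complex.I)) := by
    have h := (Complex.continuous_Gamma_vertical (mul_pos hB hγ)).measurable.comp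
      (measurable_const_mul B)
    convert h using 2 with t
    simp only [Function.comp]
    push_cast
    ring_nf
  refine (hG.mul_prod hE).mono' ?_ ?_
  · refine Measurable.aestronglyMeasurable ?_
    refine ((hmeas.comp measurable_fst).mul ?_).mul (Measurable.mul ?_ ?_)
    · exact measurable_const.pow (by fun_prop)
    · fun_prop
    · exact (Complex.measurable_ofReal.comp measurable_snd).pow (by fun_prop)
  · have h : ∀ᵐ p ∂(volume : Measure ℝ).prod (volume.restrict (Set.Ioi (0 : ℝ))),
        p.2 ∈ Set.Ioi (0 : ℝ) :=
      Measure.quasiMeasurePreserving_snd.ae (ae_restrict_mem measurableSet_Ioi)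
    filter_upwards [h] with p (hp : 0 < p.2)
    rw [norm_mul, norm_mul, norm_mul, Complex.norm_cpow_eq_rpow_re_of_pos hz,
      Complex.norm_cpow_eq_rpow_re_of_pos hp]
    simp [Complex.norm_exp]

/-- The Mellin-Barnes integral as a Laplace-type integral:
`H^{1,1}_{1,1}[z | (0, A); (0, B)] = B⁻¹ ∫₀^∞ e^{-v} exp (-(z v^A)^{1/B}) dv`. -/
theorem integral_foxIntegrand {A B γ z : ℝ} (hB : 0 < B) (hγ : 0 < γ)
    (hγA : A * γ < 1) (hz : 0 < z) :
    Integrable (foxIntegrand 1 1 1 1 ![(0, A)] ![(0, B)] z γ) ∧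
    foxLineIntegral 1 1 1 1 ![(0, A)] ![(0, B)] z γ = (B : ℂ)⁻¹ *
      (∫ v in Set.Ioi (0 : ℝ), Real.exp (-v) * Real.exp (-(z * v ^ A) ^ (1 / B)) : ℝ) := by
  have hint := integrable_foxIntegrand_prod (A := A) hB hγ hγA hz
  have hinner : ∀ t : ℝ, ∫ v in Set.Ioi (0 : ℝ), Complex.Gamma (B * (γ + t * Complex.I)) *
      (z : ℂ) ^ (-(γ + t * Complex.I : ℂ)) * ((Real.exp (-v) : ℂ) *
        (v : ℂ) ^ (1 - A * (γ + t * Complex.I) - 1 : ℂ)) =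
      foxIntegrand 1 1 1 1 ![(0, A)] ![(0, B)] z γ t := fun t ↦ by
    rw [integral_const_mul, foxIntegrand_one_one, Complex.Gamma_eq_integral (s := 1 - _),
      Complex.GammaIntegral]
    · ring
    · simp; linarith
  have hI : Integrable (foxIntegrand 1 1 1 1 ![(0, A)] ![(0, B)] z γ) := by
    refine hint.integral_prod_left.congr (Filter.Eventually.of_forall fun t ↦ hinner t)
  refine ⟨hI, ?_⟩
  have hsw := integral_integral_swap (f := fun t v : ℝ ↦ Complex.Gamma (B * (γ + t * Complex.I)) *
      (z : ℂ) ^ (-(γ + t * Complex.I : ℂ)) * ((Real.exp (-v) : ℂ) *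
        (v : ℂ) ^ (1 - A * (γ + t * Complex.I) - 1 : ℂ))) hint
  simp_rw [hinner] at hsw
  have hpi : (2 * Real.pi * Complex.I : ℂ)⁻¹ * Complex.I = (2 * Real.pi : ℂ)⁻¹ := by
    rw [mul_inv, mul_assoc, inv_mul_cancel₀ Complex.I_ne_zero, mul_one]
  rw [foxLineIntegral, integral_mul_const, mul_comm (integral _ _) Complex.I,
    ← mul_assoc (_⁻¹), hpi, hsw, ← integral_complex_ofReal,
    ← integral_const_mul, ← integral_const_mul]
  refine setIntegral_congr_fun measurableSet_Ioi fun v (hv : 0 < v) ↦ ?_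
  have hx : 0 < z * v ^ A := by positivity
  have key := integral_Gamma_mul_cpow hB hγ hx
  calc _ = (2 * Real.pi : ℂ)⁻¹ * ∫ t : ℝ, (Real.exp (-v) : ℂ) *
        (((z * v ^ A : ℝ) : ℂ) ^ (-(γ + t * Complex.I : ℂ)) *
          Complex.Gamma (B * (γ + t * Complex.I))) := by
        congr 2
        ext t
        rw [Complex.ofReal_mul, Complex.mul_cpow_ofReal_nonneg hz.le (by positivity),
          ← Complex.cpow_mul_ofReal_nonneg hv.le]
        rw [show (1 - A * (γ + t * Complex.I) - 1 : ℂ) = A * -(γ + t * Complex.I) by ring]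
        ring
    _ = _ := by
        rw [integral_const_mul, mul_left_comm, key]
        push_cast
        ring

/-- Since the Mellin-Barnes integral has the same value along all separating lines, that value is
the one of the H-function. -/
theorem foxHWellDefined_one_one {A B z : ℝ} (hA : 0 < A) (hB : 0 < B) (hz : 0 < z) :
    FoxHWellDefined 1 1 1 1 ![(0, A)] ![(0, B)] z ∧
    foxH 1 1 1 1 ![(0, A)] ![(0, B)] z = (B : ℂ)⁻¹ *
      (∫ v in Set.Ioi (0 : ℝ), Real.exp (-v) * Real.exp (-(z * v ^ A) ^ (1 / B)) : ℝ) := by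
  have hex : ∃ γ : ℝ, FoxSeparates 1 1 1 1 ![(0, A)] ![(0, B)] γ :=
    ⟨1 / A / 2, (foxSeparates_one_one_iff hA hB).2 ⟨by positivity, half_lt_self (by positivity)⟩⟩
  have key : ∀ γ : ℝ, FoxSeparates 1 1 1 1 ![(0, A)] ![(0, B)] γ → _ := fun γ hγ ↦
    have h := (foxSeparates_one_one_iff hA hB).1 hγ
    integral_foxIntegrand (A := A) hB h.1 (by have := (lt_div_iff₀ hA).1 h.2; linarith) hz
  have hH : foxH 1 1 1 1 ![(0, A)] ![(0, B)] (z : ℂ) =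
      foxLineIntegral 1 1 1 1 ![(0, A)] ![(0, B)] z hex.choose := by
    rw [foxH, dif_pos hex]
  have hH' := hH.trans (key _ hex.choose_spec).2
  exact ⟨⟨hex, fun γ hγ ↦ ⟨(key γ hγ).1, (key γ hγ).2.trans hH'.symm⟩⟩, hH'⟩

/-! ### The distance to the nearest point of a Poisson process -/

theorem pointCount_eq_zero_iff {Ω : Type*} (Φ : Ω → Set Plane) (B : Set Plane) (ω : Ω) :
    pointCount Φ B ω = 0 ↔ Φ ω ∩ B = ∅ := Set.encard_eq_zero

theorem measurable_pointCount_pointProcessSigma {Ω : Type*} (Φ : Ω → Set Plane) {B : Set Plane}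
    (hB : MeasurableSet B) : Measurable[pointProcessSigma Φ] (pointCount Φ B) :=
  measurable_iff_comap_le.2 (le_iSup₂_of_le B hB le_rfl)

theorem nearestDist_nonneg {Ω : Type*} (Φ : Ω → Set Plane) (ω : Ω) : 0 ≤ nearestDist Φ ω :=
  Metric.infDist_nonneg

theorem nearestDist_le_norm {Ω : Type*} {Φ : Ω → Set Plane} {ω : Ω} {x : Plane} (hx : x ∈ Φ ω) :
    nearestDist Φ ω ≤ ‖x‖ := by
  rw [← dist_zero_left]
  exact Metric.infDist_le_dist_of_mem hx

theorem nearestDist_lt_iff {Ω : Type*} {Φ : Ω → Set Plane} {ω : Ω} (hne : (Φ ω).Nonempty)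
    (x : ℝ) : nearestDist Φ ω < x ↔ pointCount Φ (Metric.ball 0 x) ω ≠ 0 := by
  rw [nearestDist, Metric.infDist_lt_iff hne, Ne, pointCount_eq_zero_iff, ← Ne,
    ← Set.nonempty_iff_ne_empty]
  simp [Set.Nonempty, dist_comm]

/-- The distance to the nearest point is a function of the counts of the process: for `x > 0` it is
less than `x` when there is a point in the ball of radius `x`, or no point at all (then the
infimum distance is `0` by convention). -/
theorem measurable_nearestDist {Ω : Type*} (Φ : Ω → Set Plane) :
    Measurable[pointProcessSigma Φ] (nearestDist Φ) := by
  let _ := pointProcessSigma Φ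
  refine measurable_of_Iio fun x ↦ ?_
  rcases le_or_gt x 0 with hx | hx
  · convert MeasurableSet.empty
    ext ω
    simpa using hx.trans (nearestDist_nonneg Φ ω)
  · have : nearestDist Φ ⁻¹' Set.Iio x =
        {ω | pointCount Φ (Metric.ball 0 x) ω ≠ 0} ∪ {ω | pointCount Φ Set.univ ω = 0} := by
      ext ω
      rcases (Φ ω).eq_empty_or_nonempty with h | h
      · simp [nearestDist, h, pointCount, hx]
      · have h' : pointCount Φ Set.univ ω ≠ 0 := by
          rw [Ne, pointCount_eq_zero_iff, Set.inter_univ]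
          exact h.ne_empty
        simpa [h'] using nearestDist_lt_iff h x
    rw [this]
    refine MeasurableSet.union ?_ ?_
    · exact (measurable_pointCount_pointProcessSigma Φ measurableSet_ball
        (measurableSet_singleton 0)).compl
    · exact measurable_pointCount_pointProcessSigma Φ MeasurableSet.univ (measurableSet_singleton 0)

instance nullSingletonClass_expMeasure (r : ℝ) : NullSingletonClass (expMeasure r) := by
  unfold expMeasure gammaMeasure; infer_instance

theorem expMeasure_Ici {t : ℝ} (ht : 0 ≤ t) :
    expMeasure 1 (Set.Ici t) = ENNReal.ofReal (Real.exp (-t)) := by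
  have : IsProbabilityMeasure (expMeasure 1) := isProbabilityMeasure_expMeasure one_pos
  rw [← measure_congr (Ioi_ae_eq_Ici (μ := expMeasure 1) (a := t)), ← Set.compl_Iic,
    prob_compl_eq_one_sub measurableSet_Iic, ← ofReal_cdf, cdf_expMeasure_eq one_pos, if_pos ht,
    ← ENNReal.ofReal_one, ← ENNReal.ofReal_sub _ (by simpa using ht)]
  simp

namespace IsHomogeneousPPP

variable {Ω : Type*} [mΩ : MeasurableSpace Ω] {P : Measure Ω} {Φ : Ω → Set Plane} {lam : ℝ}

theorem pointProcessSigma_le (h : IsHomogeneousPPP P Φ lam) : pointProcessSigma Φ ≤ mΩ :=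
  iSup₂_le fun B hB ↦ measurable_iff_comap_le.1 (h.measurable_count B hB)

theorem measurable_nearestDist (h : IsHomogeneousPPP P Φ lam) : Measurable (nearestDist Φ) :=
  (_root_.measurable_nearestDist Φ).mono h.pointProcessSigma_le le_rfl

theorem measure_pointCount_ball_eq_zero (h : IsHomogeneousPPP P Φ lam) {x : ℝ} (hx : 0 ≤ x) :
    P {ω | pointCount Φ (Metric.ball 0 x) ω = 0} =
      ENNReal.ofReal (Real.exp (-(lam * Real.pi * x ^ 2))) := by
  have hv : volume.real (Metric.ball (0 : Plane) x) = Real.pi * x ^ 2 := by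
    rw [measureReal_def, EuclideanSpace.volume_ball_fin_two]
    simp [hx, Real.pi_pos.le, mul_comm]
  have := h.poisson (Metric.ball 0 x) measurableSet_ball measure_ball_lt_top.ne 0
  simpa [hv, mul_assoc] using this

/-- A Poisson process of positive density has a point almost surely: the void probabilities of balls
tend to zero. -/
theorem ae_nonempty (h : IsHomogeneousPPP P Φ lam) (hlam : 0 < lam) :
    ∀ᵐ ω ∂P, (Φ ω).Nonempty := by
  have hle : ∀ n : ℕ, P {ω | ¬ (Φ ω).Nonempty} ≤
      ENNReal.ofReal (Real.exp (-(lam * Real.pi * (n : ℝ) ^ 2))) := fun n ↦ by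
    rw [← h.measure_pointCount_ball_eq_zero n.cast_nonneg]
    refine measure_mono fun ω hω ↦ ?_
    rw [Set.mem_ofPred_eq, Set.not_nonempty_iff_eq_empty] at hω
    simp [pointCount, hω]
  have hpi : 0 < lam * Real.pi := mul_pos hlam Real.pi_pos
  have hlim : Filter.Tendsto
      (fun n : ℕ ↦ ENNReal.ofReal (Real.exp (-(lam * Real.pi * (n : ℝ) ^ 2))))
      Filter.atTop (nhds 0) := by
    rw [← ENNReal.ofReal_zero]
    refine ENNReal.tendsto_ofReal (Real.tendsto_exp_neg_atTop_nhds_zero.comp ?_)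
    exact ((Filter.tendsto_pow_atTop two_ne_zero).comp tendsto_natCast_atTop_atTop).const_mul_atTop
      hpi
  exact le_antisymm (ge_of_tendsto' hlim hle) zero_le

/-- The area-scaled squared distance `π lam X²` to the nearest point is exponential of rate one. -/
theorem map_nearestDist [IsProbabilityMeasure P] (h : IsHomogeneousPPP P Φ lam) (hlam : 0 < lam) :
    P.map (fun ω ↦ Real.pi * lam * nearestDist Φ ω ^ 2) = expMeasure 1 := by
  have : IsProbabilityMeasure (expMeasure 1) := isProbabilityMeasure_expMeasure one_pos
  have hpi : 0 < Real.pi * lam := mul_pos Real.pi_pos hlam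
  have hm : Measurable fun ω ↦ Real.pi * lam * nearestDist Φ ω ^ 2 :=
    (h.measurable_nearestDist.pow_const 2).const_mul _
  have : IsProbabilityMeasure (P.map fun ω ↦ Real.pi * lam * nearestDist Φ ω ^ 2) :=
    Measure.isProbabilityMeasure_map hm.aemeasurable
  refine Measure.ext_of_Ici _ _ fun t ↦ ?_
  rw [Measure.map_apply hm measurableSet_Ici]
  rcases le_or_gt t 0 with ht | ht
  · have h1 : (fun ω ↦ Real.pi * lam * nearestDist Φ ω ^ 2) ⁻¹' Set.Ici t = Set.univ :=
      Set.eq_univ_of_forall fun ω ↦ ht.trans (by positivity)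
    have h2 : expMeasure 1 (Set.Ici 0) = 1 := by simp [expMeasure_Ici le_rfl]
    rw [h1, measure_univ]
    exact (le_antisymm prob_le_one (h2 ▸ measure_mono (Set.Ici_subset_Ici.2 ht))).symm
  · rw [expMeasure_Ici ht.le]
    have hx : t = lam * Real.pi * √(t / (Real.pi * lam)) ^ 2 := by
      rw [Real.sq_sqrt (by positivity)]; field_simp
    conv_rhs => rw [hx, ← h.measure_pointCount_ball_eq_zero (Real.sqrt_nonneg _)]
    refine measure_congr ?_
    filter_upwards [h.ae_nonempty hlam] with ω hω
    refine propext ?_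
    change t ≤ Real.pi * lam * nearestDist Φ ω ^ 2 ↔ pointCount Φ _ ω = 0
    rw [← not_iff_not, ← Ne, ← nearestDist_lt_iff hω, not_le,
      Real.lt_sqrt (nearestDist_nonneg Φ _), lt_div_iff₀ hpi, mul_comm]

theorem ae_nearestDist_pos [IsProbabilityMeasure P] (h : IsHomogeneousPPP P Φ lam)
    (hlam : 0 < lam) : ∀ᵐ ω ∂P, 0 < nearestDist Φ ω := by
  have hm : Measurable fun ω ↦ Real.pi * lam * nearestDist Φ ω ^ 2 :=
    (h.measurable_nearestDist.pow_const 2).const_mul _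
  have hae : ∀ᵐ u ∂expMeasure 1, u ≠ 0 :=
    compl_mem_ae_iff.2 (measure_singleton 0)
  rw [← h.map_nearestDist hlam] at hae
  filter_upwards [ae_of_ae_map hm.aemeasurable hae] with ω hω
  refine lt_of_le_of_ne (nearestDist_nonneg Φ _) fun h0 ↦ hω ?_
  have h0' : nearestDist Φ ω = 0 := h0.symm
  simp [h0']

/-- Almost surely there is a nearest point, because the process is locally finite. -/
theorem ae_exists_nearest (h : IsHomogeneousPPP P Φ lam) (hlam : 0 < lam) :
    ∀ᵐ ω ∂P, ∃ x ∈ Φ ω, ‖x‖ = nearestDist Φ ω := by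
  filter_upwards [h.locallyFinite, h.ae_nonempty hlam] with ω hfin hne
  obtain ⟨y, hy⟩ := hne
  have hK := hfin (Metric.closedBall 0 ‖y‖) Metric.isBounded_closedBall
  obtain ⟨x, hx, hmin⟩ := Set.exists_min_image _ (fun x : Plane ↦ ‖x‖) hK
    ⟨y, hy, by simp⟩
  refine ⟨x, hx.1, le_antisymm ?_ ?_⟩
  · refine (Metric.le_infDist ⟨y, hy⟩).2 fun w hw ↦ ?_
    rw [dist_zero_left]
    rcases le_total ‖w‖ ‖y‖ with hwy | hwy
    · exact hmin w ⟨hw, by simpa using hwy⟩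
    · exact (hmin y ⟨hy, by simp⟩).trans hwy
  · exact nearestDist_le_norm hx.1

end IsHomogeneousPPP

/-! ### Two independent exponential variables -/

theorem expMeasure_one_eq_withDensity :
    expMeasure 1 = (volume.restrict (Set.Ioi 0)).withDensity
      fun v ↦ ENNReal.ofReal (Real.exp (-v)) := by
  rw [← withDensity_indicator measurableSet_Ioi]
  change volume.withDensity (exponentialPDF 1) = _
  refine withDensity_congr_ae ?_
  have h0 : ∀ᵐ v : ℝ, v ≠ 0 := compl_mem_ae_iff.2 (measure_singleton 0)
  filter_upwards [h0] with v hv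
  rcases lt_or_gt_of_ne hv with h | h
  · rw [exponentialPDF_of_neg h, Set.indicator_of_notMem (by simpa using h.le)]
  · rw [exponentialPDF_of_nonneg h.le, Set.indicator_of_mem (by exact h)]
    simp

/-- Conditioning on the first of two independent rate-one exponential variables `V, U`:
`P((z V^A)^{1/B} ≤ U) = ∫₀^∞ e^{-v} exp (-(z v^A)^{1/B}) dv`. -/
theorem expMeasure_prod_real_setOf_le {A B z : ℝ} (hz : 0 < z) :
    ((expMeasure 1).prod (expMeasure 1)).real {p | (z * p.1 ^ A) ^ (1 / B) ≤ p.2} =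
      ∫ v in Set.Ioi (0 : ℝ), Real.exp (-v) * Real.exp (-(z * v ^ A) ^ (1 / B)) := by
  have : IsProbabilityMeasure (expMeasure 1) := isProbabilityMeasure_expMeasure one_pos
  have hs : MeasurableSet {p : ℝ × ℝ | (z * p.1 ^ A) ^ (1 / B) ≤ p.2} :=
    measurableSet_le (by fun_prop) measurable_snd
  have hm : Measurable fun v : ℝ ↦ Real.exp (-v) * Real.exp (-(z * v ^ A) ^ (1 / B)) := by
    fun_prop
  rw [integral_eq_lintegral_of_nonneg_ae (Filter.Eventually.of_forall fun v ↦ by positivity)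
    hm.aestronglyMeasurable, measureReal_def, Measure.prod_apply hs]
  congr 1
  conv_lhs => rw [expMeasure_one_eq_withDensity]
  rw [lintegral_withDensity_eq_lintegral_mul₀ (by fun_prop)
    (by rw [← expMeasure_one_eq_withDensity]
        exact (measurable_measure_prodMk_left hs).aemeasurable)]
  refine setLIntegral_congr_fun measurableSet_Ioi fun v (hv : 0 < v) ↦ ?_
  have hset : Prod.mk v ⁻¹' {p : ℝ × ℝ | (z * p.1 ^ A) ^ (1 / B) ≤ p.2} =
      Set.Ici ((z * v ^ A) ^ (1 / B)) := rfl
  simp only [Pi.mul_apply]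
  rw [← expMeasure_one_eq_withDensity, hset, expMeasure_Ici (by positivity),
    ← ENNReal.ofReal_mul (Real.exp_pos _).le]

theorem prod_setOf_snd_eq_null {μ ν : Measure ℝ} [SFinite ν] [NullSingletonClass ν]
    {f : ℝ → ℝ} (hf : Measurable f) : (μ.prod ν) {p | f p.1 = p.2} = 0 := by
  have hs : MeasurableSet {p : ℝ × ℝ | f p.1 = p.2} :=
    measurableSet_eq_fun (hf.comp measurable_fst) measurable_snd
  rw [Measure.measure_prod_null hs]
  refine Filter.Eventually.of_forall fun v ↦ ?_
  have : Prod.mk v ⁻¹' {p : ℝ × ℝ | f p.1 = p.2} = {f v} := by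
    ext u; simp [eq_comm]
  simp [this]

/-- The area-scaled squared distances to the nearest points of two independent processes are
independent, because each is measurable for the σ-algebra of the counts of its process. -/
theorem map_nearestDist_prod {Ω : Type*} [MeasurableSpace Ω] {P : Measure Ω}
    [IsProbabilityMeasure P] {Φ Ψ : Ω → Set Plane} {a b : ℝ} (hΦ : IsHomogeneousPPP P Φ a)
    (hΨ : IsHomogeneousPPP P Ψ b) (ha : 0 < a) (hb : 0 < b)
    (hindep : Indep (pointProcessSigma Φ) (pointProcessSigma Ψ) P) :
    P.map (fun ω ↦ (Real.pi * a * nearestDist Φ ω ^ 2, Real.pi * b * nearestDist Ψ ω ^ 2)) =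
      (expMeasure 1).prod (expMeasure 1) := by
  have hmeas : ∀ c : ℝ, Measurable fun x : ℝ ↦ Real.pi * c * x ^ 2 := fun c ↦ by fun_prop
  have hi : IndepFun (nearestDist Φ) (nearestDist Ψ) P := by
    rw [IndepFun_iff_Indep]
    exact indep_of_indep_of_le_left (indep_of_indep_of_le_right hindep
      (measurable_iff_comap_le.1 (measurable_nearestDist Ψ)))
      (measurable_iff_comap_le.1 (measurable_nearestDist Φ))
  have hi' := hi.comp (hmeas a) (hmeas b)
  have h := hi'.map_prod_eq_prod_map_map
    ((hmeas a).comp hΦ.measurable_nearestDist).aemeasurable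
    ((hmeas b).comp hΨ.measurable_nearestDist).aemeasurable
  exact h.trans (congrArg₂ Measure.prod (hΦ.map_nearestDist ha) (hΨ.map_nearestDist hb))

/-! ### Comparing the received powers of the two tiers -/

theorem foxArg_pos {lam W G α : Tier → ℝ} (hlam : ∀ k, 0 < lam k) (hW : ∀ k, 0 < W k)
    (hG : ∀ k, 0 < G k) : 0 < foxArg lam W G α := by
  have hM := hlam .Mcell
  have hS := hlam .Scell
  have h1 := mul_pos (hW .Mcell) (hG .Mcell)
  have h2 := mul_pos (hW .Scell) (hG .Scell)
  have := Real.pi_pos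
  unfold foxArg
  positivity

/-- In terms of the exponential variables `U_k = π lam_k X_k²`, the macro tier is received with the
same power as the small-cell tier exactly at the threshold `U_M = (z √U_S)^{2 α_S / α_M}`. -/
theorem foxArg_mul_rpow_eq {lam W G α : Tier → ℝ} (hlam : ∀ k, 0 < lam k) (hW : ∀ k, 0 < W k)
    (hG : ∀ k, 0 < G k) (hα : ∀ k, 0 < α k) {x : ℝ} (hx : 0 < x) :
    (foxArg lam W G α * (Real.pi * lam .Scell * x ^ 2) ^ (1 / 2 : ℝ)) ^
        (1 / (1 / 2 * (α .Mcell / α .Scell))) =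
      Real.pi * lam .Mcell *
        (((W .Scell * G .Scell) / (W .Mcell * G .Mcell))⁻¹ * x ^ α .Scell) ^ (2 / α .Mcell) := by
  have hM := mul_pos Real.pi_pos (hlam .Mcell)
  have hS := mul_pos Real.pi_pos (hlam .Scell)
  have hαM := hα .Mcell
  have hαS := hα .Scell
  have hw : 0 < (W .Mcell * G .Mcell) / (W .Scell * G .Scell) :=
    div_pos (mul_pos (hW _) (hG _)) (mul_pos (hW _) (hG _))
  rw [inv_div, foxArg]
  set w := (W .Mcell * G .Mcell) / (W .Scell * G .Scell)
  set a := Real.pi * lam .Mcell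
  set b := Real.pi * lam .Scell
  have h1 : (b * x ^ 2) ^ (1 / 2 : ℝ) = √b * x := by
    rw [← Real.sqrt_eq_rpow, Real.sqrt_mul hS.le, Real.sqrt_sq hx.le]
  have h2 : w ^ (1 / α .Scell) * x = (w * x ^ α .Scell) ^ (1 / α .Scell) := by
    rw [Real.mul_rpow hw.le (by positivity), ← Real.rpow_mul hx.le, mul_one_div_cancel hαS.ne',
      Real.rpow_one]
  have h3 : √a ^ (α .Mcell / α .Scell) * w ^ (1 / α .Scell) * (√b)⁻¹ * (√b * x) =
      √a ^ (α .Mcell / α .Scell) * (w ^ (1 / α .Scell) * x) := by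
    have : √b ≠ 0 := (Real.sqrt_pos.2 hS).ne'
    field_simp
  rw [h1, h3, h2, Real.mul_rpow (by positivity) (by positivity), ← Real.rpow_mul (by positivity),
    ← Real.rpow_mul (by positivity)]
  congr 1
  · rw [show α .Mcell / α .Scell * (1 / (1 / 2 * (α .Mcell / α .Scell))) = (2 : ℝ) by field_simp,
      Real.rpow_two, Real.sq_sqrt hM.le]
  · congr 1
    field_simp

theorem rpow_neg_le_iff_foxArg {lam W G α : Tier → ℝ} (hlam : ∀ k, 0 < lam k)
    (hW : ∀ k, 0 < W k) (hG : ∀ k, 0 < G k) (hα : ∀ k, 0 < α k) {x y : ℝ} (hx : 0 < x)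
    (hy : 0 < y) :
    (y ^ (-α .Mcell) ≤ (W .Scell * G .Scell) / (W .Mcell * G .Mcell) * x ^ (-α .Scell) ↔
      (foxArg lam W G α * (Real.pi * lam .Scell * x ^ 2) ^ (1 / 2 : ℝ)) ^
        (1 / (1 / 2 * (α .Mcell / α .Scell))) ≤ Real.pi * lam .Mcell * y ^ 2) ∧
    ((W .Scell * G .Scell) / (W .Mcell * G .Mcell) * x ^ (-α .Scell) ≤ y ^ (-α .Mcell) ↔
      Real.pi * lam .Mcell * y ^ 2 ≤
        (foxArg lam W G α * (Real.pi * lam .Scell * x ^ 2) ^ (1 / 2 : ℝ)) ^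
          (1 / (1 / 2 * (α .Mcell / α .Scell)))) := by
  have hM := mul_pos Real.pi_pos (hlam .Mcell)
  have hαM := hα .Mcell
  have hc : 0 < (W .Scell * G .Scell) / (W .Mcell * G .Mcell) :=
    div_pos (mul_pos (hW _) (hG _)) (mul_pos (hW _) (hG _))
  rw [foxArg_mul_rpow_eq hlam hW hG hα hx, Real.rpow_neg hx.le, Real.rpow_neg hy.le]
  set c := (W .Scell * G .Scell) / (W .Mcell * G .Mcell)
  have hy2 : y ^ 2 = (y ^ α .Mcell) ^ (2 / α .Mcell) := by
    rw [← Real.rpow_mul hy.le, mul_div_cancel₀ _ hαM.ne', Real.rpow_two]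
  have hcx : c * (x ^ α .Scell)⁻¹ = (c⁻¹ * x ^ α .Scell)⁻¹ := by rw [mul_inv, inv_inv]
  have hX : 0 < c⁻¹ * x ^ α .Scell := by positivity
  have hY : 0 < y ^ α .Mcell := by positivity
  have he : 0 < 2 / α .Mcell := by positivity
  rw [hcx, hy2, inv_le_inv₀ hY hX, inv_le_inv₀ hX hY, mul_le_mul_iff_right₀ hM,
    mul_le_mul_iff_right₀ hM, Real.rpow_le_rpow_iff hX.le hY.le he,
    Real.rpow_le_rpow_iff hY.le hX.le he]
  exact ⟨Iff.rfl, Iff.rfl⟩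

section TwoTier

variable {Ω : Type*} [MeasurableSpace Ω] {P : Measure Ω} [IsProbabilityMeasure P]
  {Φ : Tier → Ω → Set Plane} {lam W G α : Tier → ℝ}

/-- The probability that the nearest small-cell base station is received at least as strongly as the
nearest macro base station, for powers `W`; ties have probability zero. -/
theorem measureReal_macro_le_small (hlam : ∀ k, 0 < lam k) (hW : ∀ k, 0 < W k)
    (hG : ∀ k, 0 < G k) (hα : ∀ k, 0 < α k) (hΦ : ∀ k, IsHomogeneousPPP P (Φ k) (lam k))
    (hindep : Indep (pointProcessSigma (Φ .Mcell)) (pointProcessSigma (Φ .Scell)) P) :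
    P.real {ω | nearestDist (Φ .Mcell) ω ^ (-α .Mcell) ≤
        (W .Scell * G .Scell) / (W .Mcell * G .Mcell) * nearestDist (Φ .Scell) ω ^ (-α .Scell)} =
      (∫ v in Set.Ioi (0 : ℝ), Real.exp (-v) * Real.exp (-(foxArg lam W G α * v ^ (1 / 2 : ℝ)) ^
        (1 / (1 / 2 * (α .Mcell / α .Scell))))) ∧
    ∀ᵐ ω ∂P, nearestDist (Φ .Mcell) ω ^ (-α .Mcell) ≠
      (W .Scell * G .Scell) / (W .Mcell * G .Mcell) * nearestDist (Φ .Scell) ω ^ (-α .Scell) := by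
  have : IsProbabilityMeasure (expMeasure 1) := isProbabilityMeasure_expMeasure one_pos
  have hmap := map_nearestDist_prod (hΦ .Scell) (hΦ .Mcell) (hlam _) (hlam _) hindep.symm
  have hm : Measurable fun ω ↦ (Real.pi * lam .Scell * nearestDist (Φ .Scell) ω ^ 2,
      Real.pi * lam .Mcell * nearestDist (Φ .Mcell) ω ^ 2) :=
    (((hΦ .Scell).measurable_nearestDist.pow_const 2).const_mul _).prodMk
      (((hΦ .Mcell).measurable_nearestDist.pow_const 2).const_mul _)
  have hfm : Measurable fun v : ℝ ↦ (foxArg lam W G α * v ^ (1 / 2 : ℝ)) ^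
      (1 / (1 / 2 * (α .Mcell / α .Scell))) := by fun_prop
  have hfm' : Measurable fun p : ℝ × ℝ ↦ (foxArg lam W G α * p.1 ^ (1 / 2 : ℝ)) ^
      (1 / (1 / 2 * (α .Mcell / α .Scell))) := hfm.comp measurable_fst
  constructor
  · rw [← expMeasure_prod_real_setOf_le (foxArg_pos hlam hW hG), ← hmap,
      map_measureReal_apply hm (measurableSet_le hfm' measurable_snd)]
    refine measureReal_congr ?_
    filter_upwards [(hΦ .Scell).ae_nearestDist_pos (hlam _),
      (hΦ .Mcell).ae_nearestDist_pos (hlam _)] with ω hS hM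
    exact propext (rpow_neg_le_iff_foxArg hlam hW hG hα hS hM).1
  · have hnull := prod_setOf_snd_eq_null (μ := expMeasure 1) (ν := expMeasure 1) hfm
    rw [← hmap, Measure.map_apply hm (measurableSet_eq_fun hfm' measurable_snd)] at hnull
    filter_upwards [(hΦ .Scell).ae_nearestDist_pos (hlam _),
      (hΦ .Mcell).ae_nearestDist_pos (hlam _), compl_mem_ae_iff.2 hnull] with ω hS hM hne heq
    have h := rpow_neg_le_iff_foxArg hlam hW hG hα hS hM
    exact hne (le_antisymm (h.1.1 heq.le) (h.2.1 heq.ge))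

end TwoTier

/-! ### Serving base stations and nearest distances -/

/-- When each tier `k` has a nearest base station, at distance `d k > 0`, the user is served by
tier `l` exactly when the nearest base station of tier `l` has the largest received power. -/
theorem exists_isServing_iff {W α : Tier → ℝ} {φ : Tier → Set Plane} {d : Tier → ℝ}
    (hW : ∀ k, 0 < W k) (hα : ∀ k, 0 < α k) (hd : ∀ k, 0 < d k)
    (hex : ∀ k, ∃ x ∈ φ k, ‖x‖ = d k) (hle : ∀ k, ∀ x ∈ φ k, d k ≤ ‖x‖) (l : Tier) :
    (∃ x, IsServing W α φ l x) ↔ ∀ k, W k * d k ^ (-α k) ≤ W l * d l ^ (-α l) := by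
  have hmono : ∀ k, ∀ x ∈ φ k, W k * ‖x‖ ^ (-α k) ≤ W k * d k ^ (-α k) := fun k x hx ↦
    mul_le_mul_of_nonneg_left
      (Real.rpow_le_rpow_of_nonpos (hd k) (hle k x hx) (neg_nonpos.2 (hα k).le)) (hW k).le
  constructor
  · rintro ⟨x, hx, h⟩ k
    obtain ⟨y, hy, hyd⟩ := hex k
    exact hyd ▸ (h k y hy).trans (hmono l x hx)
  · intro h
    obtain ⟨x, hx, hxd⟩ := hex l
    exact ⟨x, hx, fun k y hy ↦ hxd ▸ (hmono k y hy).trans (h k)⟩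

theorem exists_isServing_small_iff {W α : Tier → ℝ} {φ : Tier → Set Plane} {d : Tier → ℝ}
    (hW : ∀ k, 0 < W k) (hα : ∀ k, 0 < α k) (hd : ∀ k, 0 < d k)
    (hex : ∀ k, ∃ x ∈ φ k, ‖x‖ = d k) (hle : ∀ k, ∀ x ∈ φ k, d k ≤ ‖x‖) :
    (∃ x, IsServing W α φ .Scell x) ↔
      d .Mcell ^ (-α .Mcell) ≤ W .Scell / W .Mcell * d .Scell ^ (-α .Scell) := by
  rw [exists_isServing_iff hW hα hd hex hle, div_mul_eq_mul_div, le_div_iff₀ (hW _),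
    mul_comm (d .Mcell ^ _)]
  exact ⟨fun h ↦ h _, fun h k ↦ k.casesOn h le_rfl⟩

theorem exists_isServing_macro_iff {W α : Tier → ℝ} {φ : Tier → Set Plane} {d : Tier → ℝ}
    (hW : ∀ k, 0 < W k) (hα : ∀ k, 0 < α k) (hd : ∀ k, 0 < d k)
    (hex : ∀ k, ∃ x ∈ φ k, ‖x‖ = d k) (hle : ∀ k, ∀ x ∈ φ k, d k ≤ ‖x‖) :
    (∃ x, IsServing W α φ .Mcell x) ↔
      W .Scell / W .Mcell * d .Scell ^ (-α .Scell) ≤ d .Mcell ^ (-α .Mcell) := by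
  rw [exists_isServing_iff hW hα hd hex hle, div_mul_eq_mul_div, div_le_iff₀ (hW _),
    mul_comm (d .Mcell ^ _)]
  exact ⟨fun h ↦ h _, fun h k ↦ k.casesOn le_rfl h⟩

/-! ### The probability of the decoupled case -/

theorem lemma2 {Ω : Type*} [MeasurableSpace Ω] (P : Measure Ω) [IsProbabilityMeasure P]
    (Φ : Tier → Ω → Set Plane) (lam Pt Q G α : Tier → ℝ)
    (hlam : ∀ k, 0 < lam k) (hPt : ∀ k, 0 < Pt k) (hQ : ∀ k, 0 < Q k) (hG : ∀ k, 0 < G k)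
    (hα : ∀ k, 0 < α k)
    (hΦ : ∀ k, IsHomogeneousPPP P (Φ k) (lam k))
    (hindep : Indep (pointProcessSigma (Φ Tier.Mcell)) (pointProcessSigma (Φ Tier.Scell)) P)
    (hratio : (Pt Tier.Scell * G Tier.Scell) / (Pt Tier.Mcell * G Tier.Mcell) <
      (Q Tier.Scell * G Tier.Scell) / (Q Tier.Mcell * G Tier.Mcell)) :
    FoxHWellDefined 1 1 1 1 ![(0, 1 / 2)] ![(0, 1 / 2 * (α Tier.Mcell / α Tier.Scell))]
      (foxArg lam Q G α) ∧
    FoxHWellDefined 1 1 1 1 ![(0, 1 / 2)] ![(0, 1 / 2 * (α Tier.Mcell / α Tier.Scell))]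
      (foxArg lam Pt G α) ∧
    NullMeasurableSet (decoupledCase Φ Pt Q G α) P ∧
    NullMeasurableSet (decoupledCaseDist Φ Pt Q G α) P ∧
    (P.real (decoupledCase Φ Pt Q G α) : ℂ) =
      1 / 2 * (α Tier.Mcell / α Tier.Scell) *
        (assocH α (foxArg lam Q G α) - assocH α (foxArg lam Pt G α)) ∧
    (P.real (decoupledCaseDist Φ Pt Q G α) : ℂ) =
      1 / 2 * (α Tier.Mcell / α Tier.Scell) *
        (assocH α (foxArg lam Q G α) - assocH α (foxArg lam Pt G α)) := by
  have hB : 0 < 1 / 2 * (α .Mcell / α .Scell) :=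
    mul_pos one_half_pos (div_pos (hα _) (hα _))
  have hfoxQ := foxHWellDefined_one_one one_half_pos hB (foxArg_pos (α := α) hlam hQ hG)
  have hfoxP := foxHWellDefined_one_one one_half_pos hB (foxArg_pos (α := α) hlam hPt hG)
  have hprobQ := (measureReal_macro_le_small hlam hQ hG hα hΦ hindep).1
  obtain ⟨hprobP, htie⟩ := measureReal_macro_le_small hlam hPt hG hα hΦ hindep
  have hmeas : ∀ c : ℝ, MeasurableSet {ω | nearestDist (Φ .Mcell) ω ^ (-α .Mcell) ≤
      c * nearestDist (Φ .Scell) ω ^ (-α .Scell)} := fun c ↦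
    measurableSet_le ((hΦ .Mcell).measurable_nearestDist.pow_const _)
      (((hΦ .Scell).measurable_nearestDist.pow_const _).const_mul _)
  -- Downlink preference for the small cell implies uplink preference for it, since the power ratio
  -- is larger in uplink; the decoupled case is the difference of the two events.
  have hdiff : decoupledCaseDist Φ Pt Q G α =
      {ω | nearestDist (Φ .Mcell) ω ^ (-α .Mcell) ≤
        (Q .Scell * G .Scell) / (Q .Mcell * G .Mcell) *
          nearestDist (Φ .Scell) ω ^ (-α .Scell)} \
      {ω | nearestDist (Φ .Mcell) ω ^ (-α .Mcell) ≤
        (Pt .Scell * G .Scell) / (Pt .Mcell * G .Mcell) *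
          nearestDist (Φ .Scell) ω ^ (-α .Scell)} := by
    ext ω
    simp only [decoupledCaseDist, Set.mem_sdiff, Set.mem_ofPred_eq, not_le, gt_iff_lt]
    exact and_comm
  have hsub : {ω | nearestDist (Φ .Mcell) ω ^ (-α .Mcell) ≤
        (Pt .Scell * G .Scell) / (Pt .Mcell * G .Mcell) *
          nearestDist (Φ .Scell) ω ^ (-α .Scell)} ⊆
      {ω | nearestDist (Φ .Mcell) ω ^ (-α .Mcell) ≤
        (Q .Scell * G .Scell) / (Q .Mcell * G .Mcell) *
          nearestDist (Φ .Scell) ω ^ (-α .Scell)} := fun ω hω ↦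
    le_trans hω (mul_le_mul_of_nonneg_right hratio.le
      (Real.rpow_nonneg (nearestDist_nonneg _ _) _))
  have hDist : MeasurableSet (decoupledCaseDist Φ Pt Q G α) :=
    hdiff ▸ (hmeas _).diff (hmeas _)
  have hprob : (P.real (decoupledCaseDist Φ Pt Q G α) : ℂ) =
      1 / 2 * (α Tier.Mcell / α Tier.Scell) *
        (assocH α (foxArg lam Q G α) - assocH α (foxArg lam Pt G α)) := by
    have hBc : ((1 / 2 * (α .Mcell / α .Scell) : ℝ) : ℂ) ≠ 0 := by exact_mod_cast hB.ne'
    rw [hdiff, measureReal_sdiff hsub (hmeas _), hprobQ, hprobP, assocH, assocH, hfoxQ.2, hfoxP.2,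
      ← mul_sub, ← mul_assoc, Complex.ofReal_sub]
    rw [show (1 / 2 * (α .Mcell / α .Scell) : ℂ) = ((1 / 2 * (α .Mcell / α .Scell) : ℝ) : ℂ) by
      push_cast; rfl, mul_inv_cancel₀ hBc, one_mul]
  -- The two descriptions of the decoupled case differ only where the downlink powers are tied.
  have hae : decoupledCase Φ Pt Q G α =ᵐ[P] decoupledCaseDist Φ Pt Q G α := by
    have hpos : ∀ k, ∀ᵐ ω ∂P, 0 < nearestDist (Φ k) ω := fun k ↦
      (hΦ k).ae_nearestDist_pos (hlam k)
    have hnear : ∀ k, ∀ᵐ ω ∂P, ∃ x ∈ Φ k ω, ‖x‖ = nearestDist (Φ k) ω := fun k ↦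
      (hΦ k).ae_exists_nearest (hlam k)
    filter_upwards [hpos .Mcell, hpos .Scell, hnear .Mcell, hnear .Scell, htie]
      with ω hM hS hMn hSn hne
    have hd : ∀ k, 0 < nearestDist (Φ k) ω := fun k ↦ by cases k <;> assumption
    have hex : ∀ k, ∃ x ∈ Φ k ω, ‖x‖ = nearestDist (Φ k) ω := fun k ↦ by cases k <;> assumption
    have hle : ∀ k, ∀ x ∈ Φ k ω, nearestDist (Φ k) ω ≤ ‖x‖ := fun k x hx ↦ nearestDist_le_norm hx
    have hu := exists_isServing_small_iff (fun k ↦ mul_pos (hQ k) (hG k)) hα hd hex hle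
    have hdl := exists_isServing_macro_iff (fun k ↦ mul_pos (hPt k) (hG k)) hα hd hex hle
    refine propext ((and_congr hu hdl).trans ⟨fun h ↦ ⟨lt_of_le_of_ne h.2 hne.symm, h.1⟩,
      fun h ↦ ⟨h.2, h.1.le⟩⟩)
  exact ⟨hfoxQ.1, hfoxP.1, hDist.nullMeasurableSet.congr hae.symm, hDist.nullMeasurableSet,
    (measureReal_congr hae).symm ▸ hprob, hprob⟩
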